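/- Let $k$ be an algebraically closed field with $\mathrm{char}(k)\neq 2$, and let $D_4$ be the Hopf algebra over $k$ (the Drinfeld double of Sweedler's 4-dimensional Hopf algebra) generated as an algebra by $a,b,c,d$ with relations $$ba=-ab,\quad db=-bd,\quad ca=-ac,\quad dc=-cd,\quad bc=cb,\quad a^2=0,\quad b^2=1,\quad c^2=1,\quad d^2=0,\quad da+ad=1-bc,$$ with comultiplication $\Delta(a)=a\otimes b+1\otimes a$, $\Delta(b)=b\otimes b$, $\Delta(c)=c\otimes c$, $\Delta(d)=d\otimes c+1\otimes d$ and counit $\varepsilon(a)=\varepsilon(d)=0$, $\varepsilon(b)=\varepsilon(c)=1$. Tensor products $M\otimes N=M\otimes_k N$ of $D_4$-modules carry the action through $\Delta$, and $nM$ denotes the direct sum of $n$ copies of $M$ (so $0M=0$). For $r\in\mathbb Z_2=\mathbb Z/2\mathbb Z$ let $P(r)$ be the 4-dimensional $D_4$-module with basis $v_1,v_2,v_3,v_4$ such that $a v_1=v_2$, $a v_3=v_4$, $a v_2=a v_4=0$, $d v_1=v_3$, $d v_2=-v_4$, $d v_3=d v_4=0$, and $b$ and $c$ both act by $(-1)^r$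 on $v_1,v_4$ and by $(-1)^{r+1}$ on $v_2,v_3$. (This is the projective cover of the one-dimensional simple module on which $a,d$ act by $0$ and $b,c$ by $(-1)^r$.) For $s\geq 1$, $r\in\mathbb Z_2$ and $\eta\in\mathbb P^1(k)=k\cup\{\infty\}$ let $M_s(r,\eta)$ be the $2s$-dimensional indecomposable $D_4$-module with basis $v_{1,1},\dots,v_{1,s},v_{2,1},\dots,v_{2,s}$ such that $b$ and $c$ both act by $(-1)^{r+1}$ on every $v_{1,i}$ and by $(-1)^r$ on every $v_{2,i}$, $a v_{2,i}=d v_{2,i}=0$, and, with $v_{2,0}=0$, $$a v_{1,i}=v_{2,i},\quad d v_{1,i}=-v_{2,i-1}-\eta v_{2,i}\quad\text{if }\eta\in k,\qquad\qquad a v_{1,i}=v_{2,i-1},\quad d v_{1,i}=v_{2,i}\quad\text{if }\eta=\infty .$$ **Proposition.** Let $t\geq s\geq 1$, $r,r'\in\mathbb Z_2$ and $\eta\in\mathbb P^1(k)$. Then there is an isomorphism of $D_4$-modules $$M_s(r,\eta)\otimes M_t(r',\eta)\;\cong\; s(t-1)P(r+r')\oplus M_s(0,\eta)\oplus M_s(1,\eta).$$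 -/

import Mathlib

open scoped TensorProduct

noncomputable section

/-! ### The Hopf algebra `D₄` -/

/-- The four generators of the algebra `D₄`. -/
inductive D4Gen : Type
  | a | b | c | d

/-- The defining relations of `D₄`. -/
inductive D4Rel (k : Type*) [Field k] : FreeAlgebra k D4Gen → FreeAlgebra k D4Gen → Prop
  | ba : D4Rel k (FreeAlgebra.ι k .b * FreeAlgebra.ι k .a)
      (-(FreeAlgebra.ι k .a * FreeAlgebra.ι k .b))
  | db : D4Rel k (FreeAlgebra.ι k .d * FreeAlgebra.ι k .b)
      (-(FreeAlgebra.ι k .b * FreeAlgebra.ι k .d))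
  | ca : D4Rel k (FreeAlgebra.ι k .c * FreeAlgebra.ι k .a)
      (-(FreeAlgebra.ι k .a * FreeAlgebra.ι k .c))
  | dc : D4Rel k (FreeAlgebra.ι k .d * FreeAlgebra.ι k .c)
      (-(FreeAlgebra.ι k .c * FreeAlgebra.ι k .d))
  | bc : D4Rel k (FreeAlgebra.ι k .b * FreeAlgebra.ι k .c)
      (FreeAlgebra.ι k .c * FreeAlgebra.ι k .b)
  | aa : D4Rel k (FreeAlgebra.ι k .a * FreeAlgebra.ι k .a) 0
  | bb : D4Rel k (FreeAlgebra.ι k .b * FreeAlgebra.ι k .b) 1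
  | cc : D4Rel k (FreeAlgebra.ι k .c * FreeAlgebra.ι k .c) 1
  | dd : D4Rel k (FreeAlgebra.ι k .d * FreeAlgebra.ι k .d) 0
  | da : D4Rel k (FreeAlgebra.ι k .d * FreeAlgebra.ι k .a + FreeAlgebra.ι k .a * FreeAlgebra.ι k .d)
      (1 - FreeAlgebra.ι k .b * FreeAlgebra.ι k .c)

/-- The `k`-algebra `D₄` generated by `a, b, c, d` subject to `ba = -ab`, `db = -bd`, `ca = -ac`,
`dc = -cd`, `bc = cb`, `a² = 0`, `b² = 1`, `c² = 1`, `d² = 0`, `da + ad = 1 - bc`. -/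
def D4 (k : Type*) [Field k] : Type _ := RingQuot (D4Rel k)

namespace D4

instance (k : Type*) [Field k] : Ring (D4 k) := inferInstanceAs (Ring (RingQuot (D4Rel k)))

instance (k : Type*) [Field k] : Algebra k (D4 k) :=
  inferInstanceAs (Algebra k (RingQuot (D4Rel k)))

/-- The quotient map from the free algebra onto `D₄`. -/
def mk (k : Type*) [Field k] : FreeAlgebra k D4Gen →ₐ[k] D4 k :=
  RingQuot.mkAlgHom k (D4Rel k)

/-- The class of a generator in `D₄`. -/
def gen (k : Type*) [Field k] (x : D4Gen) : D4 k := mk k (FreeAlgebra.ι k x)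

/-- Four elements `a, b, c, d` of an algebra satisfy the defining relations of `D₄`. -/
structure Sat {A : Type*} [Ring A] (a b c d : A) : Prop where
  ba : b * a = -(a * b)
  db : d * b = -(b * d)
  ca : c * a = -(a * c)
  dc : d * c = -(c * d)
  bc : b * c = c * b
  aa : a * a = 0
  bb : b * b = 1
  cc : c * c = 1
  dd : d * d = 0
  da : d * a + a * d = 1 - b * c

/-- The function on generators with the values `a, b, c, d`. -/
def onGen {A : Type*} (a b c d : A) : D4Gen → A
  | .a => a
  | .b => b
  | .c => c
  | .d => d

/-- The universal property of `D₄`. -/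
def lift {k : Type*} [Field k] {A : Type*} [Ring A] [Algebra k A] {a b c d : A}
    (h : Sat a b c d) : D4 k →ₐ[k] A :=
  RingQuot.liftAlgHom k ⟨FreeAlgebra.lift k (onGen a b c d), by
    intro x y hxy
    cases hxy <;> simp [onGen, h.ba, h.db, h.ca, h.dc, h.bc, h.aa, h.bb, h.cc, h.dd, h.da]⟩

@[simp] theorem lift_gen {k : Type*} [Field k] {A : Type*} [Ring A] [Algebra k A] {a b c d : A}
    (h : Sat a b c d) (x : D4Gen) : lift (k := k) h (gen k x) = onGen a b c d x := by
  unfold lift gen mk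
  erw [RingQuot.liftAlgHom_mkAlgHom_apply]
  simp

theorem algHom_ext {k : Type*} [Field k] {A : Type*} [Ring A] [Algebra k A]
    {f g : D4 k →ₐ[k] A} (h : ∀ x, f (gen k x) = g (gen k x)) : f = g := by
  refine RingQuot.ringQuot_ext' k f g ?_
  ext x
  exact h x

theorem sat_gen (k : Type*) [Field k] : Sat (gen k .a) (gen k .b) (gen k .c) (gen k .d) := by
  have key : ∀ {x y}, D4Rel k x y → mk k x = mk k y := fun h => RingQuot.mkAlgHom_rel k h
  constructor
  · simpa [gen] using key .ba
  · simpa [gen] using key .db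
  · simpa [gen] using key .ca
  · simpa [gen] using key .dc
  · simpa [gen] using key .bc
  · simpa [gen] using key .aa
  · simpa [gen] using key .bb
  · simpa [gen] using key .cc
  · simpa [gen] using key .dd
  · simpa [gen] using key .da

/-- The comultiplication: `Δ a = a ⊗ b + 1 ⊗ a`, `Δ b = b ⊗ b`, `Δ c = c ⊗ c`,
`Δ d = d ⊗ c + 1 ⊗ d`. -/
def comulHom (k : Type*) [Field k] : D4 k →ₐ[k] D4 k ⊗[k] D4 k :=
  lift (a := gen k .a ⊗ₜ gen k .b + 1 ⊗ₜ gen k .a) (b := gen k .b ⊗ₜ gen k .b)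
    (c := gen k .c ⊗ₜ gen k .c) (d := gen k .d ⊗ₜ gen k .c + 1 ⊗ₜ gen k .d) (by
    have h := sat_gen k
    have hda : gen k .d * gen k .a = 1 - gen k .b * gen k .c - gen k .a * gen k .d :=
      eq_sub_of_add_eq h.da
    constructor <;>
      simp only [mul_add, add_mul, Algebra.TensorProduct.tmul_mul_tmul, one_mul, mul_one,
        h.ba, h.db, h.ca, h.dc, h.bc, h.aa, h.bb, h.cc, h.dd, hda, TensorProduct.tmul_neg,
        TensorProduct.neg_tmul, TensorProduct.tmul_zero, TensorProduct.zero_tmul,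
        TensorProduct.sub_tmul, TensorProduct.tmul_sub, Algebra.TensorProduct.one_def,
        neg_add] <;> abel)

/-- The counit: `ε a = ε d = 0`, `ε b = ε c = 1`. -/
def counitHom (k : Type*) [Field k] : D4 k →ₐ[k] k :=
  lift (a := 0) (b := 1) (c := 1) (d := 0) (by constructor <;> simp)

instance (k : Type*) [Field k] : Bialgebra k (D4 k) :=
  Bialgebra.ofAlgHom (comulHom k) (counitHom k)
    (by
      apply algHom_ext
      intro x
      cases x <;> simp [comulHom, onGen, TensorProduct.add_tmul, TensorProduct.tmul_add,
        Algebra.TensorProduct.one_def, add_assoc])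
    (by
      apply algHom_ext
      intro x
      cases x <;> simp [comulHom, counitHom, onGen])
    (by
      apply algHom_ext
      intro x
      cases x <;> simp [comulHom, counitHom, onGen])

/-! ### Modules over `D₄` -/

/-- A (left) `D₄`-module structure on the `k`-vector space `V`. -/
abbrev Rep (k : Type*) [Field k] (V : Type*) [AddCommGroup V] [Module k V] : Type _ :=
  D4 k →ₐ[k] Module.End k V

/-- Isomorphism of `D₄`-modules. -/
def Iso {k : Type*} [Field k] {V W : Type*} [AddCommGroup V] [Module k V] [AddCommGroup W]
    [Module k W] (ρ : Rep k V) (σ : Rep k W) : Prop :=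
  ∃ e : V ≃ₗ[k] W, ∀ (x : D4 k) (v : V), e (ρ x v) = σ x (e v)

/-- The tensor product of two `D₄`-modules over `k`, on which `x` acts through `Δ x`. -/
def Rep.tensor {k : Type*} [Field k] {V W : Type*} [AddCommGroup V] [Module k V]
    [AddCommGroup W] [Module k W] (ρ : Rep k V) (σ : Rep k W) : Rep k (V ⊗[k] W) :=
  ((Module.endTensorEndAlgHom (R := k) (S := k) (A := k) (M := V) (N := W)).comp
    (Algebra.TensorProduct.map ρ σ)).comp (Bialgebra.comulAlgHom k (D4 k))

/-- The direct sum of two `D₄`-modules. -/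
def Rep.directSum {k : Type*} [Field k] {V W : Type*} [AddCommGroup V] [Module k V]
    [AddCommGroup W] [Module k W] (ρ : Rep k V) (σ : Rep k W) : Rep k (V × W) :=
  (LinearMap.prodMapAlgHom k V W).comp (ρ.prod σ)

/-- The direct sum `nV` of `n` copies of a `D₄`-module `V`. -/
def Rep.copies {k : Type*} [Field k] {V : Type*} [AddCommGroup V] [Module k V]
    (n : ℕ) (ρ : Rep k V) : Rep k (Fin n → V) where
  toFun x := (ρ x).compLeft (Fin n)
  map_one' := by ext; simp
  map_mul' _ _ := by ext; simp
  map_zero' := by ext; simp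
  map_add' _ _ := by ext; simp
  commutes' _ := by ext; simp [Algebra.algebraMap_eq_smul_one]

/-- The sign `(-1)^r` for `r ∈ ℤ/2ℤ`. -/
def sgn (k : Type*) [Field k] (r : ZMod 2) : k := (-1) ^ r.val

theorem sgn_succ (k : Type*) [Field k] (r : ZMod 2) : sgn k (r + 1) = -sgn k r := by
  have h : r = 0 ∨ r = 1 := by revert r; decide
  rcases h with rfl | rfl
  · simp [sgn, ZMod.val_one]
  · rw [show (1 + 1 : ZMod 2) = 0 from rfl]
    simp [sgn, ZMod.val_one]

theorem sgn_mul_self (k : Type*) [Field k] (r : ZMod 2) : sgn k r * sgn k r = 1 := by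
  rw [sgn, ← mul_pow]; simp

/-- The `D₄`-module `P(r)`. On its standard basis `v₁, v₂, v₃, v₄` the action is
`a v₁ = v₂`, `a v₃ = v₄`, `a v₂ = a v₄ = 0`, `d v₁ = v₃`, `d v₂ = -v₄`, `d v₃ = d v₄ = 0`,
while `b` and `c` both act by `(-1)^r, (-1)^(r+1), (-1)^(r+1), (-1)^r`. -/
def repP (k : Type*) [Field k] (r : ZMod 2) : Rep k (Fin 4 → k) :=
  (Matrix.toLinAlgEquiv' (R := k) (n := Fin 4)).toAlgHom.comp (lift
    (a := !![0, 0, 0, 0; 1, 0, 0, 0; 0, 0, 0, 0; 0, 0, 1, 0])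
    (b := Matrix.diagonal ![sgn k r, sgn k (r + 1), sgn k (r + 1), sgn k r])
    (c := Matrix.diagonal ![sgn k r, sgn k (r + 1), sgn k (r + 1), sgn k r])
    (d := !![0, 0, 0, 0; 0, 0, 0, 0; 1, 0, 0, 0; 0, -1, 0, 0]) (by
    have h := sgn_mul_self k r
    rw [sgn_succ]
    constructor <;> ext i j <;> fin_cases i <;> fin_cases j <;>
      simp [h, Matrix.mul_apply, Matrix.vecMul_diagonal, Fin.sum_univ_four]))

/-- The nilpotent shift of `kˢ` sending the `i`-th standard basis vector to the `(i-1)`-st one, and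
the first one to `0`. -/
def shift (k : Type*) [Field k] (s : ℕ) : (Fin s → k) →ₗ[k] (Fin s → k) where
  toFun x j := if h : (j : ℕ) + 1 < s then x ⟨j + 1, h⟩ else 0
  map_add' x y := by ext j; dsimp only [Pi.add_apply]; split_ifs <;> simp
  map_smul' c x := by ext j; dsimp only [Pi.smul_apply]; split_ifs <;> simp

/-- The linear map `kˢ → kˢ` giving the action of `a` from the span of the `v_{1,i}` to the span of
the `v_{2,i}` in `M_s(r, η)`: `v_{1,i} ↦ v_{2,i}` if `η ∈ k`, and `v_{1,i} ↦ v_{2,i-1}` if `η = ∞`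
(with `v_{2,0} = 0`). -/
def opA (k : Type*) [Field k] (s : ℕ) : OnePoint k → ((Fin s → k) →ₗ[k] (Fin s → k))
  | none => shift k s
  | some _ => LinearMap.id

/-- The linear map `kˢ → kˢ` giving the action of `d` from the span of the `v_{1,i}` to the span of
the `v_{2,i}` in `M_s(r, η)`: `v_{1,i} ↦ -v_{2,i-1} - η v_{2,i}` if `η ∈ k`, and
`v_{1,i} ↦ v_{2,i}` if `η = ∞` (with `v_{2,0} = 0`). -/
def opD (k : Type*) [Field k] (s : ℕ) : OnePoint k → ((Fin s → k) →ₗ[k] (Fin s → k))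
  | none => LinearMap.id
  | some η => -shift k s - η • LinearMap.id

/-- The `D₄`-module `M_s(r, η)`, for `η ∈ ℙ¹(k) = k ∪ {∞}`. Its underlying space is `kˢ × kˢ`; the
standard basis of the first factor is `v_{1,1}, …, v_{1,s}`, that of the second factor is
`v_{2,1}, …, v_{2,s}`. Both `b` and `c` act by `(-1)^(r+1)` on the first factor and by `(-1)^r` on
the second one; `a` and `d` vanish on the second factor and map the first factor to the second one
by `opA` and `opD`. -/
def repM (k : Type*) [Field k] (s : ℕ) (r : ZMod 2) (η : OnePoint k) :
    Rep k ((Fin s → k) × (Fin s → k)) :=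
  lift
    (a := LinearMap.inr k _ _ ∘ₗ opA k s η ∘ₗ LinearMap.fst k _ _)
    (b := (sgn k (r + 1) • LinearMap.id).prodMap (sgn k r • LinearMap.id))
    (c := (sgn k (r + 1) • LinearMap.id).prodMap (sgn k r • LinearMap.id))
    (d := LinearMap.inr k _ _ ∘ₗ opD k s η ∘ₗ LinearMap.fst k _ _) (by
    have h := sgn_mul_self k r
    constructor <;> refine LinearMap.ext fun x => Prod.ext ?_ ?_ <;>
      simp [sgn_succ, h, Module.End.mul_apply, smul_smul])

/-! ### Well-definedness of `M_s(r, η)`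

The module `M_{s+1}(r, η)` is, up to isomorphism, the unique indecomposable extension of `M_1(r, η)`
by `M_s(r, η)`. -/

/-- Indecomposability of a `D₄`-module. -/
def Indecomposable {k : Type*} [Field k] {V : Type*} [AddCommGroup V] [Module k V]
    (ρ : Rep k V) : Prop :=
  Nontrivial V ∧ ∀ U W : Submodule k V, (∀ x, ∀ v ∈ U, ρ x v ∈ U) → (∀ x, ∀ v ∈ W, ρ x v ∈ W) →
    IsCompl U W → U = ⊥ ∨ W = ⊥

/-- There is an exact sequence `0 → V' → V → V'' → 0` of `D₄`-modules. -/
def IsExtension {k : Type*} [Field k] {V' V V'' : Type*} [AddCommGroup V'] [Module k V']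
    [AddCommGroup V] [Module k V] [AddCommGroup V''] [Module k V'']
    (ρ' : Rep k V') (ρ : Rep k V) (ρ'' : Rep k V'') : Prop :=
  ∃ (i : V' →ₗ[k] V) (p : V →ₗ[k] V''), Function.Injective i ∧ Function.Surjective p ∧
    Function.Exact i p ∧ (∀ x v, i (ρ' x v) = ρ x (i v)) ∧ (∀ x v, p (ρ x v) = ρ'' x (p v))

theorem induction {k : Type*} [Field k] {C : D4 k → Prop} (x : D4 k)
    (hk : ∀ c : k, C (algebraMap k _ c)) (hg : ∀ g, C (gen k g))
    (hm : ∀ x y, C x → C y → C (x * y)) (ha : ∀ x y, C x → C y → C (x + y)) : C x := by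
  obtain ⟨y, rfl⟩ := RingQuot.mkAlgHom_surjective k (D4Rel k) x
  change C (mk k y)
  induction y using FreeAlgebra.induction with
  | grade0 c => rw [AlgHom.commutes]; exact hk c
  | grade1 g => exact hg g
  | mul x y hx hy => rw [map_mul]; exact hm _ _ hx hy
  | add x y hx hy => rw [map_add]; exact ha _ _ hx hy

/-- The element of `D₄` acting as the identity from the first factor of `M_s(r, η)` to the second
one. -/
def genP (k : Type*) [Field k] : OnePoint k → D4 k
  | none => gen k .d
  | some _ => gen k .a

/-- The element of `D₄` acting as the shift from the first factor of `M_s(r, η)` to the second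
one. -/
def genQ (k : Type*) [Field k] : OnePoint k → D4 k
  | none => gen k .a
  | some η => -gen k .d - η • gen k .a

section

variable {k : Type*} [Field k] {V : Type*} [AddCommGroup V] [Module k V]

theorem repM_genP (s : ℕ) (r : ZMod 2) (η : OnePoint k) (v) :
    repM k s r η (genP k η) v = (0, v.1) := by
  rcases η with _ | η <;> simp [repM, genP, onGen, opA, opD]

theorem repM_genQ (s : ℕ) (r : ZMod 2) (η : OnePoint k) (v) :
    repM k s r η (genQ k η) v = (0, shift k s v.1) := by
  rcases η with _ | η <;> simp [repM, genQ, onGen, opA, opD]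

theorem repM_b (s : ℕ) (r : ZMod 2) (η : OnePoint k) (v) :
    repM k s r η (gen k .b) v = (sgn k (r + 1) • v.1, -(sgn k (r + 1) • v.2)) := by
  simp [repM, onGen, sgn_succ]

theorem repM_c (s : ℕ) (r : ZMod 2) (η : OnePoint k) (v) :
    repM k s r η (gen k .c) v = (sgn k (r + 1) • v.1, -(sgn k (r + 1) • v.2)) := by
  simp [repM, onGen, sgn_succ]

/-- The algebra `D₄` is generated by `b`, `c`, `genP` and `genQ`. -/
theorem induction_PQ (η : OnePoint k) {C : D4 k → Prop} (x : D4 k)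
    (hk : ∀ c : k, C (algebraMap k _ c)) (hb : C (gen k .b)) (hc : C (gen k .c))
    (hP : C (genP k η)) (hQ : C (genQ k η))
    (hm : ∀ x y, C x → C y → C (x * y)) (ha : ∀ x y, C x → C y → C (x + y)) : C x := by
  refine induction x hk ?_ hm ha
  rcases η with _ | η
  · rintro (_ | _ | _ | _)
    exacts [hQ, hb, hc, hP]
  · rintro (_ | _ | _ | _)
    · exact hP
    · exact hb
    · exact hc
    · have : gen k .d = algebraMap k _ (-1) * genQ k (some η) + algebraMap k _ (-η) * gen k .a := by
        simp [genQ, Algebra.smul_def]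
      rw [this]
      exact ha _ _ (hm _ _ (hk _) hQ) (hm _ _ (hk _) hP)

theorem single_mem_of_shift {n : ℕ} (S : Submodule k (Fin (n + 1) → k))
    (hS : ∀ x ∈ S, shift k (n + 1) x ∈ S) (x : Fin (n + 1) → k) (hx : x ∈ S) (hx0 : x ≠ 0) :
    Pi.single 0 1 ∈ S := by
  have key : ∀ (m : ℕ) (x : Fin (n + 1) → k), (∀ j : Fin (n + 1), m < j → x j = 0) → x ∈ S →
      x ≠ 0 → Pi.single 0 1 ∈ S := by
    intro m
    induction m with
    | zero =>
      intro x h hx hx0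
      have h1 : x = x 0 • Pi.single 0 1 := by
        ext j
        rcases Fin.eq_zero_or_eq_succ j with rfl | ⟨i, rfl⟩
        · simp
        · simp [h i.succ (by simp)]
      have h2 : x 0 ≠ 0 := by
        intro h2
        exact hx0 (by rw [h1, h2, zero_smul])
      rw [h1] at hx
      exact (S.smul_mem_iff h2).1 hx
    | succ m ih =>
      intro x h hx hx0
      by_cases h0 : shift k (n + 1) x = 0
      · refine ih x (fun j hj => ?_) hx hx0
        have := congrFun h0 ⟨j - 1, by omega⟩
        have hj' : (j : ℕ) - 1 + 1 = j := by omega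
        simpa [shift, hj', show (j : ℕ) - 1 < n by omega] using this
      · refine ih _ (fun j hj => ?_) (hS x hx) h0
        simp only [shift, LinearMap.coe_mk, AddHom.coe_mk]
        split_ifs with hj2
        · exact h _ (by simp; omega)
        · rfl
  exact key n x (fun j hj => absurd j.2 (by omega)) hx hx0

/-- `M_s(r, η)` is indecomposable for `s ≥ 1`. -/
theorem repM_indecomposable (hk : ringChar k ≠ 2) (n : ℕ) (r : ZMod 2) (η : OnePoint k) :
    Indecomposable (repM k (n + 1) r η) := by
  have h2 : (2 : k) ≠ 0 := Ring.two_ne_zero hk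
  have hs := sgn_mul_self k (r + 1)
  refine ⟨inferInstance, ?_⟩
  have half : ∀ U : Submodule k ((Fin (n + 1) → k) × (Fin (n + 1) → k)),
      (∀ x, ∀ v ∈ U, repM k (n + 1) r η x v ∈ U) →
      ∀ x y, (x, y) ∈ U → (x, 0) ∈ U ∧ (0, y) ∈ U := by
    intro U hU x y hxy
    have h1 := U.smul_mem (sgn k (r + 1)) (hU (gen k .b) _ hxy)
    rw [repM_b] at h1
    simp only [Prod.smul_mk, smul_neg, smul_smul, hs, one_smul] at h1
    constructor
    · have h3 := U.smul_mem (2⁻¹ : k) (U.add_mem hxy h1)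
      have e : (2⁻¹ : k) • ((x, y) + (x, -y)) = (x, (0 : Fin (n + 1) → k)) := by
        ext j <;> simp [← two_mul, h2]
      rwa [e] at h3
    · have h3 := U.smul_mem (2⁻¹ : k) (U.sub_mem hxy h1)
      have e : (2⁻¹ : k) • ((x, y) - (x, -y)) = ((0 : Fin (n + 1) → k), y) := by
        ext j <;> simp [← two_mul, h2]
      rwa [e] at h3
  have main : ∀ U W : Submodule k ((Fin (n + 1) → k) × (Fin (n + 1) → k)),
      (∀ x, ∀ v ∈ U, repM k (n + 1) r η x v ∈ U) → (∀ x, ∀ v ∈ W, repM k (n + 1) r η x v ∈ W) →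
      IsCompl U W → U ≠ ⊥ → (Pi.single 0 1, 0) ∈ U := by
    intro U W hU hW hUW hne
    have swap : ∀ y, (0, y) ∈ U → (y, 0) ∈ U := by
      intro y hy
      have : (y, (0 : Fin (n + 1) → k)) ∈ U ⊔ W := by rw [hUW.sup_eq_top]; trivial
      obtain ⟨⟨u1, u2⟩, hu, ⟨w1, w2⟩, hw, huw⟩ := Submodule.mem_sup.1 this
      have hu1 := (half U hU _ _ hu).1
      have hw1 := (half W hW _ _ hw).1
      have hu2 := hU (genP k η) _ hu1
      have hw2 := hW (genP k η) _ hw1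
      rw [repM_genP] at hu2 hw2
      have e : u1 + w1 = y := congrArg Prod.fst huw
      have hw3 : ((0 : Fin (n + 1) → k), w1) ∈ U := by
        have := U.sub_mem hy hu2
        simpa [← e] using this
      have h0 := Submodule.disjoint_def.1 hUW.disjoint _ hw3 hw2
      have h0' : w1 = 0 := congrArg Prod.snd h0
      rw [h0', add_zero] at e
      rwa [← e]
    obtain ⟨⟨x, y⟩, hxy, hne⟩ := (Submodule.ne_bot_iff _).1 hne
    let S : Submodule k (Fin (n + 1) → k) := U.comap (LinearMap.inl k _ _)
    have hS : ∀ x ∈ S, shift k (n + 1) x ∈ S := by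
      intro x hx
      have := hU (genQ k η) _ hx
      rw [repM_genQ] at this
      exact swap _ this
    have hx : x ∈ S := (half U hU _ _ hxy).1
    have hy : y ∈ S := swap _ (half U hU _ _ hxy).2
    by_cases hx0 : x = 0
    · by_cases hy0 : y = 0
      · exact absurd (by rw [hx0, hy0]; rfl) hne
      · exact single_mem_of_shift S hS y hy hy0
    · exact single_mem_of_shift S hS x hx hx0
  intro U W hU hW hUW
  by_contra! hcon
  have h1 := main U W hU hW hUW hcon.1
  have h3 := main W U hW hU hUW.symm hcon.2
  have h0 := Submodule.disjoint_def.1 hUW.disjoint _ h1 h3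
  have := congrFun (congrArg Prod.fst h0) 0
  simp at this

theorem shift_init {n : ℕ} (x : Fin (n + 2) → k) :
    Fin.init (shift k (n + 2) x) =
      shift k (n + 1) (Fin.init x) + x (Fin.last _) • Pi.single (Fin.last n) 1 := by
  ext j
  rcases Fin.eq_castSucc_or_eq_last j with ⟨i, rfl⟩ | rfl
  · simp [shift, Fin.init, Fin.castSucc_ne_last]
  · simp [shift, Fin.init]
    rfl

theorem shift_last {n : ℕ} (x : Fin (n + 1) → k) : shift k (n + 1) x (Fin.last n) = 0 := by
  simp [shift]

/-- The inclusion `kⁿ → kⁿ⁺¹` by a last coordinate zero, on both factors. -/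
def incl (k : Type*) [Field k] (n : ℕ) :
    ((Fin n → k) × (Fin n → k)) →ₗ[k] ((Fin (n + 1) → k) × (Fin (n + 1) → k)) where
  toFun v := (Fin.snoc (α := fun _ => k) v.1 0, Fin.snoc (α := fun _ => k) v.2 0)
  map_add' x y := by
    ext j <;> refine Fin.lastCases ?_ (fun i => ?_) j <;> simp
  map_smul' c x := by
    ext j <;> refine Fin.lastCases ?_ (fun i => ?_) j <;> simp

/-- The projection of `kⁿ⁺¹` to the last coordinate, on both factors. -/
def projLast (k : Type*) [Field k] (n : ℕ) :
    ((Fin (n + 1) → k) × (Fin (n + 1) → k)) →ₗ[k] ((Fin 1 → k) × (Fin 1 → k)) where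
  toFun v := (fun _ => v.1 (Fin.last n), fun _ => v.2 (Fin.last n))
  map_add' _ _ := rfl
  map_smul' _ _ := rfl

theorem shift_snoc {n : ℕ} (x : Fin n → k) :
    shift k (n + 1) (Fin.snoc (α := fun _ => k) x 0) =
      Fin.snoc (α := fun _ => k) (shift k n x) 0 := by
  ext j
  refine Fin.lastCases ?_ (fun i => ?_) j
  · simp [shift]
  · simp only [shift, LinearMap.coe_mk, AddHom.coe_mk, Fin.snoc_castSucc, Fin.val_castSucc]
    rw [dif_pos (by omega)]
    by_cases h : (i : ℕ) + 1 < n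
    · rw [dif_pos h]
      exact Fin.snoc_castSucc (α := fun _ => k) 0 x ⟨i + 1, h⟩
    · rw [dif_neg h]
      have : (⟨(i : ℕ) + 1, by omega⟩ : Fin (n + 1)) = Fin.last n := Fin.ext (by simp; omega)
      rw [this, Fin.snoc_last]

/-- `M_{s+1}(r, η)` is an extension of `M_1(r, η)` by `M_s(r, η)`. -/
theorem repM_isExtension (n : ℕ) (r : ZMod 2) (η : OnePoint k) :
    IsExtension (repM k n r η) (repM k (n + 1) r η) (repM k 1 r η) := by
  refine ⟨incl k n, projLast k n, ?_, ?_, ?_, ?_, ?_⟩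
  · rintro ⟨x, y⟩ ⟨x', y'⟩ h
    have h1 := congrArg (fun v => Fin.init (α := fun _ => k) v.1) h
    have h2 := congrArg (fun v => Fin.init (α := fun _ => k) v.2) h
    simp only [incl, LinearMap.coe_mk, AddHom.coe_mk, Fin.init_snoc] at h1 h2
    rw [h1, h2]
  · rintro ⟨x, y⟩
    refine ⟨(fun _ => x 0, fun _ => y 0), ?_⟩
    ext j <;> simp [projLast, Subsingleton.elim j 0]
  · rintro ⟨x, y⟩
    constructor
    · intro h
      refine ⟨(Fin.init x, Fin.init y), ?_⟩
      have h1 : x (Fin.last n) = 0 := congrFun (congrArg Prod.fst h) 0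
      have h2 : y (Fin.last n) = 0 := congrFun (congrArg Prod.snd h) 0
      simp only [incl, LinearMap.coe_mk, AddHom.coe_mk]
      rw [← h1]
      conv_lhs => rw [Fin.snoc_init_self x, h1, ← h2, Fin.snoc_init_self y]
    · rintro ⟨v, hv⟩
      rw [← hv]
      ext j <;> simp [projLast, incl]
  · intro x
    refine induction_PQ η (C := fun x => ∀ v, incl k n (repM k n r η x v) =
      repM k (n + 1) r η x (incl k n v)) x ?_ ?_ ?_ ?_ ?_ ?_ ?_
    · intro c v; simp [Algebra.algebraMap_eq_smul_one]
    · intro v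
      rw [repM_b, repM_b]
      ext j <;> refine Fin.lastCases ?_ (fun i => ?_) j <;> simp [incl]
    · intro v
      rw [repM_c, repM_c]
      ext j <;> refine Fin.lastCases ?_ (fun i => ?_) j <;> simp [incl]
    · intro v
      rw [repM_genP, repM_genP]
      ext j <;> refine Fin.lastCases ?_ (fun i => ?_) j <;> simp [incl]
    · intro v
      rw [repM_genQ, repM_genQ]
      refine Prod.ext ?_ ?_
      · ext j; refine Fin.lastCases ?_ (fun i => ?_) j <;> simp [incl]
      · exact (shift_snoc v.1).symm
    · intro x y hx hy v; simp [hx, hy]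
    · intro x y hx hy v; simp [hx, hy]
  · intro x
    refine induction_PQ η (C := fun x => ∀ v, projLast k n (repM k (n + 1) r η x v) =
      repM k 1 r η x (projLast k n v)) x ?_ ?_ ?_ ?_ ?_ ?_ ?_
    · intro c v; simp [Algebra.algebraMap_eq_smul_one]
    · intro v
      rw [repM_b, repM_b]; rfl
    · intro v
      rw [repM_c, repM_c]; rfl
    · intro v
      rw [repM_genP, repM_genP]; rfl
    · intro v
      rw [repM_genQ, repM_genQ]
      ext j
      · rfl
      · simp [projLast, shift]
    · intro x y hx hy v; simp [hx, hy]
    · intro x y hx hy v; simp [hx, hy]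

theorem genP_mul_self (η : OnePoint k) : genP k η * genP k η = 0 := by
  rcases η with _ | η
  exacts [(sat_gen k).dd, (sat_gen k).aa]

theorem genP_mul_b (η : OnePoint k) : gen k .b * genP k η = -(genP k η * gen k .b) := by
  have h := sat_gen k
  rcases η with _ | η <;> simp [genP, h.ba, h.db]

theorem genQ_mul_b (η : OnePoint k) : gen k .b * genQ k η = -(genQ k η * gen k .b) := by
  have h := sat_gen k
  have h' : gen k .b * gen k .d = -(gen k .d * gen k .b) := by rw [h.db, neg_neg]
  rcases η with _ | η
  · simp [genQ, h.ba]
  · simp only [genQ, mul_sub, sub_mul, mul_neg, neg_mul, h', mul_smul_comm, smul_mul_assoc, h.ba]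
    rw [smul_neg]
    abel

theorem genQ_mul_genP (η : OnePoint k) :
    genQ k η * genP k η + genP k η * genQ k η = algebraMap k _ (match η with | none => 1 | some _ => -1)
      * (1 - gen k .b * gen k .c) := by
  have h := sat_gen k
  rcases η with _ | η
  · simp [genP, genQ, ← h.da, add_comm]
  · simp [genP, genQ, ← h.da, mul_sub, sub_mul, h.aa]; abel

/-- Every indecomposable extension of `M_1(r, η)` by `M_s(r, η)` is isomorphic to
`M_{s+1}(r, η)`, for `s ≥ 1`. -/
theorem iso_repM_of_isExtension (hk : ringChar k ≠ 2) (n : ℕ) (r : ZMod 2) (η : OnePoint k)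
    (ρ : Rep k V) (hind : Indecomposable ρ)
    (hext : IsExtension (repM k (n + 1) r η) ρ (repM k 1 r η)) :
    Iso ρ (repM k (n + 2) r η) := by
  obtain ⟨i, p, hi, hp, hex, hiρ, hpρ⟩ := hext
  have h2 : (2 : k) ≠ 0 := Ring.two_ne_zero hk
  have hs := sgn_mul_self k (r + 1)
  set ε := sgn k (r + 1) with hε
  have hsat := sat_gen k
  have hpi : ∀ z, p (i z) = 0 := fun z => (hex _).2 ⟨z, rfl⟩
  have mulv : ∀ x y v, ρ (x * y) v = ρ x (ρ y v) := fun x y v => by simp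
  -- `b` and `c` act in the same way
  have hbb : ∀ v, ρ (gen k .b) (ρ (gen k .b) v) = v := fun v => by rw [← mulv, hsat.bb]; simp
  have hcc : ∀ v, ρ (gen k .c) (ρ (gen k .c) v) = v := fun v => by rw [← mulv, hsat.cc]; simp
  have hcb : ∀ v, ρ (gen k .c) (ρ (gen k .b) v) = ρ (gen k .b) (ρ (gen k .c) v) := fun v => by
    rw [← mulv, ← mulv, hsat.bc]
  have hbc1 : ∀ v, ρ (gen k .b) (ρ (gen k .c) v) = v := by
    intro v
    have h1 : p (ρ (gen k .b) v - ρ (gen k .c) v) = 0 := by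
      rw [map_sub, hpρ, hpρ, repM_b, repM_c, sub_self]
    obtain ⟨z, hz⟩ := (hex _).1 h1
    have h3 : ρ (gen k .b) (i z) = ρ (gen k .c) (i z) := by
      rw [← hiρ, ← hiρ, repM_b, repM_c]
    rw [hz, map_sub, map_sub, hbb, hcc, hcb] at h3
    have h4 : (2 : k) • (v - ρ (gen k .b) (ρ (gen k .c) v)) = 0 := by
      rw [two_smul]
      calc _ = (v - ρ (gen k .b) (ρ (gen k .c) v)) - (ρ (gen k .b) (ρ (gen k .c) v) - v) := by abel
        _ = 0 := by rw [h3]; abel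
    exact (sub_eq_zero.1 ((smul_eq_zero.1 h4).resolve_left h2)).symm
  have hbc : ρ (gen k .c) = ρ (gen k .b) := by
    ext v
    rw [← hbb (ρ (gen k .c) v), hbc1]
  have hPP : ∀ v, ρ (genP k η) (ρ (genP k η) v) = 0 := fun v => by
    rw [← mulv, genP_mul_self]; simp
  have hQP : ∀ v, ρ (genQ k η) (ρ (genP k η) v) = -ρ (genP k η) (ρ (genQ k η) v) := by
    intro v
    rw [eq_neg_iff_add_eq_zero, ← mulv, ← mulv, ← LinearMap.add_apply, ← map_add, genQ_mul_genP,
      mulv, map_sub, map_one, LinearMap.sub_apply, mulv, hbc1]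
    simp
  have hbP : ∀ v, ρ (gen k .b) (ρ (genP k η) v) = -ρ (genP k η) (ρ (gen k .b) v) := fun v => by
    rw [← mulv, genP_mul_b]; simp
  have hbQ : ∀ v, ρ (gen k .b) (ρ (genQ k η) v) = -ρ (genQ k η) (ρ (gen k .b) v) := fun v => by
    rw [← mulv, genQ_mul_b]; simp
  -- a lift of the generator of the quotient, of the right weight
  obtain ⟨u0, hu0⟩ := hp ((fun _ => 1), 0)
  obtain ⟨u', hu'b, hu'p⟩ : ∃ u', ρ (gen k .b) u' = ε • u' ∧ p u' = ((fun _ => 1), 0) := by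
    refine ⟨(2⁻¹ : k) • (u0 + ε • ρ (gen k .b) u0), ?_, ?_⟩
    · rw [map_smul, map_add, map_smul, hbb, smul_comm, smul_add ε, smul_smul ε, hs, one_smul,
        add_comm]
    · rw [map_smul, map_add, map_smul, hpρ, hu0, repM_b, ← hε]
      ext j <;> simp [hs, ← two_mul, h2]
  obtain ⟨⟨z1, z2⟩, hz⟩ : ∃ z, i z = ρ (genQ k η) u' := by
    refine (hex _).1 ?_
    rw [hpρ, hu'p, repM_genQ]
    ext j
    · rfl
    · simp [shift]
  have hz1 : z1 = 0 := by
    have h1 := hbQ u'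
    rw [hu'b, map_smul, ← hz, ← hiρ, repM_b, ← hε, ← map_smul, ← map_neg] at h1
    have h3 := congrArg Prod.fst (hi h1)
    simp only [Prod.smul_mk, Prod.neg_mk] at h3
    have h4 : (2 * ε) • z1 = 0 := by
      rw [mul_smul, two_smul]
      nth_rewrite 1 [h3]
      simp
    refine (smul_eq_zero.1 h4).resolve_left (mul_ne_zero h2 ?_)
    rintro h0
    rw [h0] at hs
    simp at hs
  subst hz1
  obtain ⟨w, α, hw⟩ : ∃ (w : Fin (n + 1) → k) (α : k),
      z2 = shift k (n + 1) w + α • Pi.single (Fin.last n) 1 := by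
    refine ⟨Fin.cons 0 (Fin.init z2), z2 (Fin.last n), ?_⟩
    ext j
    refine Fin.lastCases ?_ (fun l => ?_) j
    · simp [shift]
    · have : (⟨(l : ℕ) + 1, by omega⟩ : Fin (n + 1)) = l.succ := rfl
      simp [shift, this, Fin.init, Fin.castSucc_ne_last]
  set u := u' - i (w, 0) with hu
  have hup : p u = ((fun _ => 1), 0) := by rw [hu, map_sub, hpi, sub_zero, hu'p]
  have hub : ρ (gen k .b) u = ε • u := by
    rw [hu, map_sub, hu'b, ← hiρ, repM_b, ← hε, smul_sub, ← map_smul]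
    simp
  have huQ : ρ (genQ k η) u = α • i (0, Pi.single (Fin.last n) 1) := by
    rw [hu, map_sub, ← hz, ← hiρ, repM_genQ, ← map_sub, ← map_smul, hw]
    simp
  set v := ρ (genP k η) u with hv
  have hvp : p v = (0, (fun _ => 1)) := by rw [hv, hpρ, hup, repM_genP]
  have hvb : ρ (gen k .b) v = -(ε • v) := by rw [hv, hbP, hub, map_smul]
  have hvP : ρ (genP k η) v = 0 := hPP u
  have hvQ : ρ (genQ k η) v = 0 := by
    rw [hv, hQP, huQ, map_smul, ← hiρ, repM_genP, Prod.mk_zero_zero, map_zero]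
    simp
  have hα : α ≠ 0 := by
    intro hα
    rw [hα, zero_smul] at huQ
    have hpc : ∀ c d : k, p (c • u + d • v) = ((fun _ => c), (fun _ => d)) := by
      intro c d
      rw [map_add, map_smul, map_smul, hup, hvp]
      ext j <;> simp
    have hor : LinearMap.range i = ⊥ ∨ Submodule.span k {u, v} = ⊥ := by
      refine hind.2 _ _ ?_ ?_ ?_
      · rintro x _ ⟨z, rfl⟩
        exact ⟨_, hiρ x z⟩
      · intro x
        refine induction_PQ η (C := fun x => ∀ y ∈ Submodule.span k {u, v},
          ρ x y ∈ Submodule.span k {u, v}) x ?_ ?_ ?_ ?_ ?_ ?_ ?_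
        · intro c y hy
          simpa [Algebra.algebraMap_eq_smul_one] using Submodule.smul_mem _ c hy
        · intro y hy
          obtain ⟨c, d, rfl⟩ := Submodule.mem_span_pair.1 hy
          rw [map_add, map_smul, map_smul, hub, hvb]
          exact Submodule.mem_span_pair.2 ⟨c * ε, -(d * ε), by module⟩
        · intro y hy
          obtain ⟨c, d, rfl⟩ := Submodule.mem_span_pair.1 hy
          rw [hbc, map_add, map_smul, map_smul, hub, hvb]
          exact Submodule.mem_span_pair.2 ⟨c * ε, -(d * ε), by module⟩
        · intro y hy
          obtain ⟨c, d, rfl⟩ := Submodule.mem_span_pair.1 hy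
          rw [map_add, map_smul, map_smul, hvP, ← hv]
          exact Submodule.mem_span_pair.2 ⟨0, c, by module⟩
        · intro y hy
          obtain ⟨c, d, rfl⟩ := Submodule.mem_span_pair.1 hy
          rw [map_add, map_smul, map_smul, huQ, hvQ]
          simp
        · intro x y hx hy z hz
          rw [mulv]
          exact hx _ (hy _ hz)
        · intro x y hx hy z hz
          rw [map_add]
          exact Submodule.add_mem _ (hx _ hz) (hy _ hz)
      · constructor
        · rw [Submodule.disjoint_def]
          rintro _ ⟨z, rfl⟩ hy
          obtain ⟨c, d, hcd⟩ := Submodule.mem_span_pair.1 hy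
          have h1 := hpc c d
          rw [hcd, hpi] at h1
          have hc : c = 0 := (congrFun (congrArg Prod.fst h1) 0).symm
          have hd : d = 0 := (congrFun (congrArg Prod.snd h1) 0).symm
          rw [← hcd, hc, hd]
          simp
        · rw [codisjoint_iff, eq_top_iff]
          intro y _
          refine Submodule.mem_sup.2 ⟨y - ((p y).1 0 • u + (p y).2 0 • v), ?_, _,
            Submodule.mem_span_pair.2 ⟨(p y).1 0, (p y).2 0, rfl⟩, by abel⟩
          refine (hex _).1 ?_
          rw [map_sub, hpc]
          ext j <;> simp [Subsingleton.elim j 0]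
    rcases hor with h | h
    · have : i (Pi.single 0 1, 0) = 0 := by
        rw [← Submodule.mem_bot k, ← h]
        exact ⟨_, rfl⟩
      have := congrFun (congrArg Prod.fst (hi (this.trans (map_zero i).symm))) 0
      simp at this
    · have hu0 : u = 0 := by
        rw [← Submodule.mem_bot k, ← h]
        exact Submodule.subset_span (by simp)
      rw [hu0, map_zero] at hup
      have := congrFun (congrArg Prod.fst hup) 0
      simp at this
  -- the isomorphism
  let e : ((Fin (n + 2) → k) × (Fin (n + 2) → k)) →ₗ[k] V :=
    { toFun := fun m => i (Fin.init (α := fun _ => k) m.1, Fin.init (α := fun _ => k) m.2) +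
        ((m.1 (Fin.last _) * α⁻¹) • u + (m.2 (Fin.last _) * α⁻¹) • v)
      map_add' := by
        intro x y
        have : ((Fin.init (α := fun _ => k) (x + y).1, Fin.init (α := fun _ => k) (x + y).2) :
            (Fin (n + 1) → k) × (Fin (n + 1) → k)) =
            (Fin.init x.1, Fin.init x.2) + (Fin.init y.1, Fin.init y.2) := rfl
        rw [this, map_add]
        simp only [Prod.fst_add, Prod.snd_add, Pi.add_apply]
        module
      map_smul' := by
        intro c x
        have : ((Fin.init (α := fun _ => k) (c • x).1, Fin.init (α := fun _ => k) (c • x).2) :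
            (Fin (n + 1) → k) × (Fin (n + 1) → k)) = c • (Fin.init x.1, Fin.init x.2) := rfl
        rw [this, map_smul]
        simp only [Prod.smul_fst, Prod.smul_snd, Pi.smul_apply, RingHom.id_apply, smul_eq_mul]
        module }
  have he : ∀ x y, e (x, y) = i (Fin.init (α := fun _ => k) x, Fin.init (α := fun _ => k) y) +
        ((x (Fin.last _) * α⁻¹) • u + (y (Fin.last _) * α⁻¹) • v) := fun _ _ => rfl
  have hpe : ∀ x y, p (e (x, y)) =
      ((fun _ => x (Fin.last _) * α⁻¹), (fun _ => y (Fin.last _) * α⁻¹)) := by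
    intro x y
    rw [he, map_add, hpi, map_add, map_smul, map_smul, hup, hvp]
    ext j <;> simp
  have hinj : Function.Injective e := by
    rw [← LinearMap.ker_eq_bot, LinearMap.ker_eq_bot']
    rintro ⟨x, y⟩ h
    have h1 := hpe x y
    rw [h, map_zero] at h1
    have hx : x (Fin.last _) = 0 := by
      simpa [hα] using (congrFun (congrArg Prod.fst h1) 0).symm
    have hy : y (Fin.last _) = 0 := by
      simpa [hα] using (congrFun (congrArg Prod.snd h1) 0).symm
    rw [he, hx, hy] at h
    simp only [zero_mul, zero_smul, add_zero] at h
    have h3 := hi (h.trans (map_zero i).symm)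
    have h4 := congrArg Prod.fst h3
    have h5 := congrArg Prod.snd h3
    refine Prod.ext (funext fun j => ?_) (funext fun j => ?_)
    · refine Fin.lastCases hx (fun l => ?_) j
      exact congrFun h4 l
    · refine Fin.lastCases hy (fun l => ?_) j
      exact congrFun h5 l
  have hsurj : Function.Surjective e := by
    intro y
    obtain ⟨⟨z1, z2⟩, hz⟩ : ∃ z, i z = y - ((p y).1 0 • u + (p y).2 0 • v) := by
      refine (hex _).1 ?_
      rw [map_sub, map_add, map_smul, map_smul, hup, hvp]
      ext j <;> simp [Subsingleton.elim j 0]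
    refine ⟨(Fin.snoc (α := fun _ => k) z1 ((p y).1 0 * α),
      Fin.snoc (α := fun _ => k) z2 ((p y).2 0 * α)), ?_⟩
    rw [he, Fin.init_snoc, Fin.init_snoc, Fin.snoc_last, Fin.snoc_last, hz, mul_assoc, mul_assoc,
      mul_inv_cancel₀ hα]
    simp
  have heq : ∀ x m, e (repM k (n + 2) r η x m) = ρ x (e m) := by
    intro x
    have hB : ∀ m, e (repM k (n + 2) r η (gen k .b) m) = ρ (gen k .b) (e m) := by
      rintro ⟨x, y⟩
      rw [repM_b, ← hε, he, he, map_add, map_add, map_smul, map_smul, hub, hvb, ← hiρ, repM_b, ← hε]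
      congr 1
      simp only [Pi.smul_apply, Pi.neg_apply, smul_eq_mul]
      module
    refine induction_PQ η (C := fun x => ∀ m, e (repM k (n + 2) r η x m) = ρ x (e m)) x ?_ hB ?_ ?_ ?_ ?_ ?_
    · intro c m
      simp [Algebra.algebraMap_eq_smul_one]
    · intro m
      rw [hbc, ← hB, repM_b, repM_c]
    · rintro ⟨x, y⟩
      rw [repM_genP, he, he, map_add, map_add, map_smul, map_smul, hvP, ← hv, ← hiρ, repM_genP]
      simp
      rfl
    · rintro ⟨x, y⟩
      rw [repM_genQ, he, he, map_add, map_add, map_smul, map_smul, hvQ, huQ, ← hiρ, repM_genQ,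
        shift_init, shift_last, smul_smul, mul_assoc, inv_mul_cancel₀ hα, ← map_smul]
      simp only [zero_mul, smul_zero, zero_smul, Pi.zero_apply, add_zero, mul_one]
      rw [map_zero, add_zero, add_zero, ← map_smul, ← map_add]
      simp
      rfl
    · intro x y hx hy m
      rw [map_mul, Module.End.mul_apply, hx, hy, mulv]
    · intro x y hx hy m
      rw [map_add, map_add, LinearMap.add_apply, LinearMap.add_apply, map_add, hx, hy]
  let E := LinearEquiv.ofBijective e ⟨hinj, hsurj⟩
  refine ⟨E.symm, fun x m => ?_⟩
  apply E.injective
  rw [E.apply_symm_apply]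
  exact ((heq x (E.symm m)).trans (congrArg _ (E.apply_symm_apply m))).symm

end

end D4

end

/-! Write `P` for `genP` and `Q` for `genQ`: on each `M_s(r, η)` they send the top half `kˢ` to the
bottom half by the identity and by the nilpotent shift `N`, whether `η` is finite or `∞`. The tensor
product thus splits into four slots `kˢ ⊗ kᵗ`, numbered 11, 12, 21, 22 by the halves used. Write
`z₁₁` for `z` placed in slot 11, and so on. With `ε = (-1)^r'`, `P z₁₁ = z₁₂ - ε z₂₁`, `Q z₁₁ = ((1
⊗ N) z)₁₂ - ε ((N ⊗ 1) z)₂₁`, `P z₁₂ = ε z₂₂`, `Q z₁₂ = ε ((N ⊗ 1) z)₂₂`. Since `M_s` is generated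
by its top half, with `Q x = P (N x)` as the essential relation, the summands can be read off. The
vectors `x ⊗ e_last` of slot 12 satisfy the relation and give `M_s(r + r')`. In slot 11 it holds
where `N ⊗ 1` and `1 ⊗ N` agree, in particular on the image of `diag`, which gives `M_s(r + r' +
1)`; here `s ≤ t` is needed. The remaining `s(t - 1)` basis vectors of slot 11 receive maps from
`P(r + r')`, which is free on a weight vector (`exists_isHom_repP`). These generators generate
everything (`eq_top_of_generators`), so the sum of the maps is surjective. Both sides have dimension
`4st`, hence it is an isomorphism (`iso_tensor`). -/

namespace D4

/-! ### Homomorphisms of `D₄`-modules, and maps out of `P(r)` and `M_s(r, η)`. -/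

section Hom

variable {k : Type*} [Field k] {V W : Type*} [AddCommGroup V] [Module k V] [AddCommGroup W]
  [Module k W]

/-- A `k`-linear map between `D₄`-modules commutes with the action of `D₄`. -/
def IsHom (ρ : Rep k V) (σ : Rep k W) (f : V →ₗ[k] W) : Prop :=
  ∀ (x : D4 k) (v : V), f (ρ x v) = σ x (f v)

theorem isHom_of_gen {ρ : Rep k V} {σ : Rep k W} {f : V →ₗ[k] W}
    (h : ∀ g v, f (ρ (gen k g) v) = σ (gen k g) (f v)) : IsHom ρ σ f := by
  intro x
  refine induction (C := fun x => ∀ v, f (ρ x v) = σ x (f v)) x ?_ h ?_ ?_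
  · intro c v
    simp [Algebra.algebraMap_eq_smul_one]
  · intro x y hx hy v
    simp only [map_mul, Module.End.mul_apply, hx, hy]
  · intro x y hx hy v
    simp only [map_add, LinearMap.add_apply, hx, hy]

/-- Testing on `genP` and `genQ` instead of `a` and `d` treats finite `η` and `η = ∞` in the same
way. -/
theorem isHom_of_genPQ (η : OnePoint k) {ρ : Rep k V} {σ : Rep k W} {f : V →ₗ[k] W}
    (hb : ∀ v, f (ρ (gen k .b) v) = σ (gen k .b) (f v))
    (hc : ∀ v, f (ρ (gen k .c) v) = σ (gen k .c) (f v))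
    (hP : ∀ v, f (ρ (genP k η) v) = σ (genP k η) (f v))
    (hQ : ∀ v, f (ρ (genQ k η) v) = σ (genQ k η) (f v)) : IsHom ρ σ f := by
  intro x
  refine induction_PQ η (C := fun x => ∀ v, f (ρ x v) = σ x (f v)) x ?_ hb hc hP hQ ?_ ?_
  · intro c v
    simp [Algebra.algebraMap_eq_smul_one]
  · intro x y hx hy v
    simp only [map_mul, Module.End.mul_apply, hx, hy]
  · intro x y hx hy v
    simp only [map_add, LinearMap.add_apply, hx, hy]

theorem IsHom.coprod {V' : Type*} [AddCommGroup V'] [Module k V'] {ρ : Rep k V} {ρ' : Rep k V'}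
    {σ : Rep k W} {f : V →ₗ[k] W} {f' : V' →ₗ[k] W} (hf : IsHom ρ σ f) (hf' : IsHom ρ' σ f') :
    IsHom (ρ.directSum ρ') σ (f.coprod f') := by
  rintro x ⟨v, v'⟩
  simp [Rep.directSum, hf x, hf' x]

theorem IsHom.lsum {n : ℕ} {ρ : Rep k V} {σ : Rep k W} {f : Fin n → V →ₗ[k] W}
    (hf : ∀ i, IsHom ρ σ (f i)) :
    IsHom (ρ.copies n) σ (LinearMap.lsum k (fun _ : Fin n => V) k f) := by
  intro x v
  simp [Rep.copies, fun i => hf i x]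

theorem Iso.symm {ρ : Rep k V} {σ : Rep k W} : Iso ρ σ → Iso σ ρ := by
  rintro ⟨e, he⟩
  exact ⟨e.symm, fun x v => e.injective (by rw [he]; simp)⟩

theorem Iso.trans {V' : Type*} [AddCommGroup V'] [Module k V'] {ρ : Rep k V} {σ : Rep k W}
    {τ : Rep k V'} : Iso ρ σ → Iso σ τ → Iso ρ τ := by
  rintro ⟨e, he⟩ ⟨e', he'⟩
  exact ⟨e.trans e', fun x v => by simp [he, he']⟩

theorem Iso.refl (ρ : Rep k V) : Iso ρ ρ := ⟨LinearEquiv.refl k V, fun _ _ => rfl⟩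

theorem Iso.directSum {V' W' : Type*} [AddCommGroup V'] [Module k V'] [AddCommGroup W']
    [Module k W'] {ρ : Rep k V} {σ : Rep k W} {ρ' : Rep k V'} {σ' : Rep k W'} :
    Iso ρ σ → Iso ρ' σ' → Iso (ρ.directSum ρ') (σ.directSum σ') := by
  rintro ⟨e, he⟩ ⟨e', he'⟩
  exact ⟨e.prodCongr e', fun x v => by simp [Rep.directSum, he, he']⟩

theorem iso_directSum_comm (ρ : Rep k V) (σ : Rep k W) :
    Iso (ρ.directSum σ) (σ.directSum ρ) :=
  ⟨LinearEquiv.prodComm k V W, fun x v => by simp [Rep.directSum]⟩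

/-- Surjectivity can be tested on module generators; a dimension count then spares any independence
argument. -/
theorem IsHom.iso_of_surjective [FiniteDimensional k V] [FiniteDimensional k W] {ρ : Rep k V}
    {σ : Rep k W} {f : V →ₗ[k] W} (hf : IsHom ρ σ f) (hs : Function.Surjective f)
    (h : Module.finrank k V = Module.finrank k W) : Iso ρ σ :=
  ⟨LinearEquiv.ofBijective f
    ⟨(LinearMap.injective_iff_surjective_of_finrank_eq_finrank h).2 hs, hs⟩, hf⟩

/-- A vector of weight `(-1)^r` for both `b` and `c` is the image of `v₁` under a homomorphism
from `P(r)`. -/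
theorem exists_isHom_repP (σ : Rep k W) (r : ZMod 2) (w : W)
    (hb : σ (gen k .b) w = sgn k r • w) (hc : σ (gen k .c) w = sgn k r • w) :
    ∃ f : (Fin 4 → k) →ₗ[k] W, IsHom (repP k r) σ f ∧ f (Pi.single 0 1) = w := by
  have h := sat_gen k
  have mulv : ∀ x y v, σ x (σ y v) = σ (x * y) v := fun x y v => by simp
  have hs := sgn_mul_self k r
  have aa : ∀ v, σ (gen k .a) (σ (gen k .a) v) = 0 := fun v => by rw [mulv, h.aa]; simp
  have dd : ∀ v, σ (gen k .d) (σ (gen k .d) v) = 0 := fun v => by rw [mulv, h.dd]; simp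
  have ba : ∀ v, σ (gen k .b) (σ (gen k .a) v) = -σ (gen k .a) (σ (gen k .b) v) := fun v => by
    rw [mulv, h.ba]; simp
  have ca : ∀ v, σ (gen k .c) (σ (gen k .a) v) = -σ (gen k .a) (σ (gen k .c) v) := fun v => by
    rw [mulv, h.ca]; simp
  have bd : ∀ v, σ (gen k .b) (σ (gen k .d) v) = -σ (gen k .d) (σ (gen k .b) v) := fun v => by
    rw [mulv, mulv, h.db]; simp
  have cd : ∀ v, σ (gen k .c) (σ (gen k .d) v) = -σ (gen k .d) (σ (gen k .c) v) := fun v => by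
    rw [mulv, mulv, h.dc]; simp
  have da : ∀ v, σ (gen k .d) (σ (gen k .a) v) =
      v - σ (gen k .b) (σ (gen k .c) v) - σ (gen k .a) (σ (gen k .d) v) := fun v => by
    rw [mulv, eq_sub_of_add_eq h.da]; simp
  -- The images of `v₁, …, v₄` are forced: `w`, `a w`, `d w`, `a d w`. The relation `d v₂ = -v₄`
  -- survives because `b c w = w`, so that `d a w = -a d w`.
  let f : (Fin 4 → k) →ₗ[k] W := Fintype.linearCombination k
    ![w, σ (gen k .a) w, σ (gen k .d) w, σ (gen k .a) (σ (gen k .d) w)]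
  have hf : ∀ v, f v = v 0 • w + v 1 • σ (gen k .a) w + v 2 • σ (gen k .d) w +
      v 3 • σ (gen k .a) (σ (gen k .d) w) := fun v => by
    simp [f, Fintype.linearCombination_apply, Fin.sum_univ_four]
  refine ⟨f, isHom_of_gen fun g v => ?_, by simp [hf]⟩
  rw [hf, hf]
  cases g <;>
    simp [repP, onGen, Matrix.mulVec, dotProduct, Fin.sum_univ_four, aa, dd,
      ba, ca, bd, cd, da, hb, hc, smul_smul, hs, sgn_succ, Matrix.diagonal_apply] <;> module

/-- A linear map from `kˢ` to vectors of weight `(-1)^(r+1)` intertwining the actions of `genQ` and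
`genP` after a shift extends to a homomorphism from `M_s(r, η)`. -/
theorem exists_isHom_repM (σ : Rep k W) (s : ℕ) (r : ZMod 2) (η : OnePoint k)
    (g : (Fin s → k) →ₗ[k] W) (hb : ∀ x, σ (gen k .b) (g x) = sgn k (r + 1) • g x)
    (hc : ∀ x, σ (gen k .c) (g x) = sgn k (r + 1) • g x)
    (hg : ∀ x, σ (genQ k η) (g x) = σ (genP k η) (g (shift k s x))) :
    ∃ f : ((Fin s → k) × (Fin s → k)) →ₗ[k] W, IsHom (repM k s r η) σ f ∧
      ∀ x, f (x, 0) = g x := by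
  have mulv : ∀ x y v, σ x (σ y v) = σ (x * y) v := fun x y v => by simp
  have hs := sgn_mul_self k (r + 1)
  have PP : ∀ v, σ (genP k η) (σ (genP k η) v) = 0 := fun v => by
    rw [mulv, genP_mul_self]; simp
  have bP : ∀ v, σ (gen k .b) (σ (genP k η) v) = -σ (genP k η) (σ (gen k .b) v) := fun v => by
    rw [mulv, genP_mul_b]; simp
  have cP : ∀ v, σ (gen k .c) (σ (genP k η) v) = -σ (genP k η) (σ (gen k .c) v) := by
    have h := sat_gen k
    intro v
    rcases η with _ | η
    · simp only [genP]
      rw [mulv, mulv, h.dc]; simp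
    · simp only [genP]
      rw [mulv, h.ca]; simp
  -- `QP + PQ` is a multiple of `1 - bc`, which kills `g x` since `b` and `c` act on it by the same
  -- sign; and `PQ (g x) = PP (g (N x)) = 0`.
  have QP : ∀ x, σ (genQ k η) (σ (genP k η) (g x)) = 0 := by
    intro x
    have h1 : σ (genQ k η * genP k η + genP k η * genQ k η) (g x) = 0 := by
      rw [genQ_mul_genP, ← mulv, map_sub, map_one, LinearMap.sub_apply, ← mulv, hc, map_smul, hb,
        smul_smul, hs]
      simp
    rw [map_add, LinearMap.add_apply, ← mulv, ← mulv, hg, PP, add_zero] at h1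
    exact h1
  -- The value on the bottom half is forced, because `(0, y) = P (y, 0)`.
  refine ⟨g.coprod (σ (genP k η) ∘ₗ g), isHom_of_genPQ η ?_ ?_ ?_ ?_, by simp⟩ <;> rintro ⟨x, y⟩
  · simp [repM_b, hb, bP]
  · simp [repM_c, hc, cP]
  · simp [repM_genP, PP]
  · simp [repM_genQ, hg, QP]

/-! ### The action of the generators on a tensor product. -/

section Tensor

variable (ρ : Rep k V) (σ : Rep k W)

theorem tensor_gen_a (v : V) (w : W) : ρ.tensor σ (gen k .a) (v ⊗ₜ w) =
    ρ (gen k .a) v ⊗ₜ σ (gen k .b) w + v ⊗ₜ σ (gen k .a) w := by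
  have : Bialgebra.comulAlgHom k (D4 k) (gen k .a) =
      gen k .a ⊗ₜ gen k .b + 1 ⊗ₜ gen k .a := by
    change comulHom k _ = _
    simp [comulHom, onGen]
  simp [Rep.tensor, this]
  rfl

theorem tensor_gen_d (v : V) (w : W) : ρ.tensor σ (gen k .d) (v ⊗ₜ w) =
    ρ (gen k .d) v ⊗ₜ σ (gen k .c) w + v ⊗ₜ σ (gen k .d) w := by
  have : Bialgebra.comulAlgHom k (D4 k) (gen k .d) =
      gen k .d ⊗ₜ gen k .c + 1 ⊗ₜ gen k .d := by
    change comulHom k _ = _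
    simp [comulHom, onGen]
  simp [Rep.tensor, this]
  rfl

theorem tensor_gen_b (v : V) (w : W) : ρ.tensor σ (gen k .b) (v ⊗ₜ w) =
    ρ (gen k .b) v ⊗ₜ σ (gen k .b) w := by
  have : Bialgebra.comulAlgHom k (D4 k) (gen k .b) = gen k .b ⊗ₜ gen k .b := by
    change comulHom k _ = _
    simp [comulHom, onGen]
  simp [Rep.tensor, this]
  rfl

theorem tensor_gen_c (v : V) (w : W) : ρ.tensor σ (gen k .c) (v ⊗ₜ w) =
    ρ (gen k .c) v ⊗ₜ σ (gen k .c) w := by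
  have : Bialgebra.comulAlgHom k (D4 k) (gen k .c) = gen k .c ⊗ₜ gen k .c := by
    change comulHom k _ = _
    simp [comulHom, onGen]
  simp [Rep.tensor, this]
  rfl

/-- `Δ a` and `Δ d` differ in form only by `b` versus `c` in the second factor. Where these agree,
every linear combination of `a` and `d` follows the same twisted Leibniz rule. -/
theorem tensor_genP (η : OnePoint k) (v : V) (w : W) (h : σ (gen k .c) w = σ (gen k .b) w) :
    ρ.tensor σ (genP k η) (v ⊗ₜ w) =
      ρ (genP k η) v ⊗ₜ σ (gen k .b) w + v ⊗ₜ σ (genP k η) w := by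
  rcases η with _ | η
  · simp [genP, tensor_gen_d, h]
  · simp [genP, tensor_gen_a]

theorem tensor_genQ (η : OnePoint k) (v : V) (w : W) (h : σ (gen k .c) w = σ (gen k .b) w) :
    ρ.tensor σ (genQ k η) (v ⊗ₜ w) =
      ρ (genQ k η) v ⊗ₜ σ (gen k .b) w + v ⊗ₜ σ (genQ k η) w := by
  rcases η with _ | η
  · simp [genQ, tensor_gen_a]
  · simp only [genQ, map_sub, map_neg, map_smul, LinearMap.sub_apply, LinearMap.neg_apply,
      LinearMap.smul_apply, tensor_gen_a, tensor_gen_d, h, TensorProduct.sub_tmul,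
      TensorProduct.tmul_sub, TensorProduct.neg_tmul, TensorProduct.tmul_neg,
      ← TensorProduct.smul_tmul', TensorProduct.tmul_smul]
    module

end Tensor

end Hom

/-! ### The shift on `kˢ ⊗ kᵗ` and the subspace where `N ⊗ 1 = 1 ⊗ N`. -/

section Shift

variable {k : Type*} [Field k]

theorem shift_pow_apply (s m : ℕ) (x : Fin s → k) (j : Fin s) :
    (shift k s ^ m) x j = if h : (j : ℕ) + m < s then x ⟨j + m, h⟩ else 0 := by
  induction m generalizing j with
  | zero => simp
  | succ m ih =>
    rw [pow_succ', Module.End.mul_apply]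
    simp only [shift, LinearMap.coe_mk, AddHom.coe_mk] at ih ⊢
    split_ifs with h1 h2 h2
    · rw [ih, dif_pos (by simp only; omega)]
      congr 2
      simp only
      omega
    · rw [ih, dif_neg (by simp only; omega)]
    · omega
    · rfl

theorem shift_pow_eq_zero {s m : ℕ} (h : s ≤ m) : shift k s ^ m = 0 := by
  refine LinearMap.ext fun x => funext fun j => ?_
  rw [shift_pow_apply, dif_neg (by omega)]
  rfl

theorem shift_single_zero (n : ℕ) : shift k (n + 1) (Pi.single 0 1) = 0 := by
  ext j
  simp only [shift, LinearMap.coe_mk, AddHom.coe_mk, Pi.single_apply, Fin.ext_iff]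
  split_ifs <;> first | rfl | simp_all

theorem shift_single_succ {n : ℕ} (j : Fin n) :
    shift k (n + 1) (Pi.single j.succ 1) = Pi.single j.castSucc 1 := by
  ext i
  simp only [shift, LinearMap.coe_mk, AddHom.coe_mk, Pi.single_apply, Fin.ext_iff,
    Fin.val_succ, Fin.val_castSucc]
  split_ifs <;> first | rfl | omega

/-- The linear map `kˢ → kˢ ⊗ kᵗ`, `eᵢ ↦ ∑ e_{i-j} ⊗ e_j`. -/
def diag (k : Type*) [Field k] (s t : ℕ) : (Fin s → k) →ₗ[k] (Fin s → k) ⊗[k] (Fin t → k) :=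
  ∑ j : Fin t, (TensorProduct.mk k _ _).flip (Pi.single j 1) ∘ₗ (shift k s ^ (j : ℕ))

theorem diag_apply (s t : ℕ) (x : Fin s → k) :
    diag k s t x = ∑ j : Fin t, (shift k s ^ (j : ℕ)) x ⊗ₜ Pi.single j 1 := by
  simp [diag]

theorem rTensor_shift_diag (s t : ℕ) (x : Fin s → k) :
    (shift k s).rTensor _ (diag k s t x) = diag k s t (shift k s x) := by
  simp only [diag_apply, map_sum, LinearMap.rTensor_tmul, ← Module.End.mul_apply, ← pow_succ,
    ← pow_succ']

/-- Applying `1 ⊗ N` to `∑ Nʲ x ⊗ e_j` lowers the index of each `e_j`, which gives `∑ Nʲ⁺¹ x ⊗ e_j`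
without its last term. That term contains `Nⁿ⁺¹`, which vanishes on `kˢ` because `s ≤ n + 1`. -/
theorem lTensor_shift_diag {s n : ℕ} (h : s ≤ n + 1) (x : Fin s → k) :
    (shift k (n + 1)).lTensor _ (diag k s (n + 1) x) = diag k s (n + 1) (shift k s x) := by
  simp only [diag_apply, map_sum, LinearMap.lTensor_tmul, ← Module.End.mul_apply, ← pow_succ]
  rw [Fin.sum_univ_succ, Fin.sum_univ_castSucc]
  simp [shift_single_zero, shift_single_succ, shift_pow_eq_zero h]

theorem eq_top_of_tmul_single (s t : ℕ) (S : Submodule k ((Fin s → k) ⊗[k] (Fin t → k)))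
    (h : ∀ x j, x ⊗ₜ Pi.single j 1 ∈ S) : S = ⊤ := by
  rw [eq_top_iff, ← TensorProduct.span_tmul_eq_top, Submodule.span_le]
  rintro _ ⟨x, y, rfl⟩
  rw [pi_eq_sum_univ' y, TensorProduct.tmul_sum]
  refine S.sum_mem fun j _ => ?_
  rw [TensorProduct.tmul_smul]
  exact S.smul_mem (y j) (h x j)

/-- Modulo `S`, `x ⊗ e_j = x ⊗ N e_{j+1}` equals `N x ⊗ e_{j+1}`, so descending induction on `j`
reduces to the last basis vector. -/
theorem eq_top_of_shift {s n : ℕ} (S : Submodule k ((Fin s → k) ⊗[k] (Fin (n + 1) → k)))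
    (hl : ∀ x, x ⊗ₜ Pi.single (Fin.last n) 1 ∈ S)
    (hS : ∀ x y, shift k s x ⊗ₜ y - x ⊗ₜ shift k (n + 1) y ∈ S) : S = ⊤ := by
  refine eq_top_of_tmul_single s (n + 1) S fun x j => ?_
  induction j using Fin.reverseInduction generalizing x with
  | last => exact hl x
  | cast j ih =>
    have := S.sub_mem (ih (shift k s x)) (hS x (Pi.single j.succ 1))
    rwa [shift_single_succ, sub_sub_cancel] at this

/-- The index `0` term of `diag x` is `x ⊗ e_0`; all its other terms lie in the span of the `e_i ⊗
e_{j+1}`. -/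
theorem eq_top_of_diag {s n : ℕ} (S : Submodule k ((Fin s → k) ⊗[k] (Fin (n + 1) → k)))
    (hd : ∀ x, diag k s (n + 1) x ∈ S)
    (hS : ∀ i (j : Fin n), Pi.single i 1 ⊗ₜ Pi.single j.succ 1 ∈ S) : S = ⊤ := by
  have key : ∀ (x : Fin s → k) (j : Fin n), x ⊗ₜ Pi.single j.succ 1 ∈ S := by
    intro x j
    rw [pi_eq_sum_univ' x, TensorProduct.sum_tmul]
    refine S.sum_mem fun i _ => ?_
    rw [← TensorProduct.smul_tmul']
    exact S.smul_mem (x i) (hS i j)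
  refine eq_top_of_tmul_single s (n + 1) S fun x j => ?_
  refine Fin.cases ?_ (key x) j
  have h := hd x
  rw [diag_apply, Fin.sum_univ_succ] at h
  simpa using (S.add_mem_iff_left (S.sum_mem fun j _ => key _ j)).1 h

end Shift

/-! ### The four slots of `M_s(r, η) ⊗ M_t(r', η)` and its decomposition. -/

section TensorM

variable {k : Type*} [Field k]

/-- The inclusion of `kˢ ⊗ kᵗ` into `M_s(r, η) ⊗ M_t(r', η)` given by linear maps from `kˢ` and `kᵗ`
to the underlying spaces of the factors. -/
abbrev slot {s t : ℕ} (f : (Fin s → k) →ₗ[k] (Fin s → k) × (Fin s → k))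
    (g : (Fin t → k) →ₗ[k] (Fin t → k) × (Fin t → k)) :
    (Fin s → k) ⊗[k] (Fin t → k) →ₗ[k]
      ((Fin s → k) × (Fin s → k)) ⊗[k] ((Fin t → k) × (Fin t → k)) :=
  TensorProduct.map f g

local notation "ι₁" => LinearMap.inl k _ _
local notation "ι₂" => LinearMap.inr k _ _

variable (s t : ℕ) (r r' : ZMod 2) (η : OnePoint k)

local notation "T" => Rep.tensor (repM k s r η) (repM k t r' η)

theorem sgn_add (r r' : ZMod 2) : sgn k (r + r') = sgn k r * sgn k r' := by
  have h : r' = 0 ∨ r' = 1 := by revert r'; decide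
  rcases h with rfl | rfl
  · simp [sgn]
  · rw [sgn_succ]
    simp [sgn, ZMod.val_one]

theorem repM_c_eq_b (v) : repM k t r' η (gen k .c) v = repM k t r' η (gen k .b) v := by
  rw [repM_b, repM_c]

theorem tensor_c_eq_b (z) : T (gen k .c) z = T (gen k .b) z := by
  induction z with
  | zero => simp
  | tmul v w => rw [tensor_gen_b, tensor_gen_c, repM_c_eq_b, repM_c_eq_b]
  | add x y hx hy => rw [map_add, map_add, hx, hy]

theorem tensor_b_slot₁₁ (z) :
    T (gen k .b) (slot ι₁ ι₁ z) = sgn k (r + r') • slot ι₁ ι₁ z := by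
  induction z with
  | zero => simp
  | tmul v w =>
    have h : ∀ (n : ℕ) (c : k) (x : Fin n → k), (c • x, (0 : Fin n → k)) = c • (x, 0) :=
      fun n c x => by simp
    simp only [TensorProduct.map_tmul, LinearMap.inl_apply, tensor_gen_b, repM_b,
      sgn_succ, smul_zero, neg_zero, h, TensorProduct.tmul_smul, ← TensorProduct.smul_tmul']
    simp only [sgn_add]
    module
  | add x y hx hy => simp only [map_add, hx, hy, smul_add]

theorem tensor_b_slot₁₂ (z) :
    T (gen k .b) (slot ι₁ ι₂ z) = sgn k (r + r' + 1) • slot ι₁ ι₂ z := by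
  induction z with
  | zero => simp
  | tmul v w =>
    have h : ∀ (n : ℕ) (c : k) (x : Fin n → k), (c • x, (0 : Fin n → k)) = c • (x, 0) :=
      fun n c x => by simp
    have h' : ∀ (n : ℕ) (c : k) (x : Fin n → k), ((0 : Fin n → k), c • x) = c • (0, x) :=
      fun n c x => by simp
    simp only [TensorProduct.map_tmul, LinearMap.inl_apply, LinearMap.inr_apply, tensor_gen_b,
      repM_b, sgn_succ, smul_zero, neg_zero, neg_neg, h, h', ← neg_smul,
      TensorProduct.tmul_smul, ← TensorProduct.smul_tmul']
    simp only [sgn_add]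
    module
  | add x y hx hy => simp only [map_add, hx, hy, smul_add]

/-- The coefficient `-(-1)^r'` is the action of `b` on the top half of the second factor, introduced
by the comultiplication. -/
theorem tensor_P_slot₁₁ (z) : T (genP k η) (slot ι₁ ι₁ z) =
    slot ι₁ ι₂ z - sgn k r' • slot ι₂ ι₁ z := by
  induction z with
  | zero => simp
  | tmul v w =>
    have h : ∀ (n : ℕ) (c : k) (x : Fin n → k), (c • x, (0 : Fin n → k)) = c • (x, 0) :=
      fun n c x => by simp
    simp only [TensorProduct.map_tmul, LinearMap.inl_apply, LinearMap.inr_apply,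
      tensor_genP _ _ _ _ _ (repM_c_eq_b _ _ _ _), repM_genP, repM_b, sgn_succ, smul_zero,
      neg_zero, h, TensorProduct.tmul_smul]
    module
  | add x y hx hy => simp only [map_add, hx, hy]; module

theorem tensor_Q_slot₁₁ (z) : T (genQ k η) (slot ι₁ ι₁ z) =
    slot ι₁ ι₂ ((shift k t).lTensor _ z) - sgn k r' • slot ι₂ ι₁ ((shift k s).rTensor _ z) := by
  induction z with
  | zero => simp
  | tmul v w =>
    have h : ∀ (n : ℕ) (c : k) (x : Fin n → k), (c • x, (0 : Fin n → k)) = c • (x, 0) :=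
      fun n c x => by simp
    simp only [TensorProduct.map_tmul, LinearMap.inl_apply, LinearMap.inr_apply,
      LinearMap.lTensor_tmul, LinearMap.rTensor_tmul,
      tensor_genQ _ _ _ _ _ (repM_c_eq_b _ _ _ _), repM_genQ, repM_b, sgn_succ, smul_zero,
      neg_zero, h, TensorProduct.tmul_smul]
    module
  | add x y hx hy => simp only [map_add, hx, hy]; module

theorem tensor_P_slot₁₂ (z) : T (genP k η) (slot ι₁ ι₂ z) = sgn k r' • slot ι₂ ι₂ z := by
  induction z with
  | zero => simp
  | tmul v w =>
    have h' : ∀ (n : ℕ) (c : k) (x : Fin n → k), ((0 : Fin n → k), c • x) = c • (0, x) :=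
      fun n c x => by simp
    simp only [TensorProduct.map_tmul, LinearMap.inl_apply, LinearMap.inr_apply,
      tensor_genP _ _ _ _ _ (repM_c_eq_b _ _ _ _), repM_genP, repM_b, sgn_succ, smul_zero,
      neg_smul, neg_neg, h', TensorProduct.tmul_smul, Prod.mk_zero_zero,
      TensorProduct.tmul_zero, add_zero]
  | add x y hx hy => simp only [map_add, hx, hy, smul_add]

theorem tensor_Q_slot₁₂ (z) : T (genQ k η) (slot ι₁ ι₂ z) =
    sgn k r' • slot ι₂ ι₂ ((shift k s).rTensor _ z) := by
  induction z with
  | zero => simp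
  | tmul v w =>
    have h' : ∀ (n : ℕ) (c : k) (x : Fin n → k), ((0 : Fin n → k), c • x) = c • (0, x) :=
      fun n c x => by simp
    simp only [TensorProduct.map_tmul, LinearMap.inl_apply, LinearMap.inr_apply, LinearMap.rTensor_tmul,
      tensor_genQ _ _ _ _ _ (repM_c_eq_b _ _ _ _), repM_genQ, repM_b, sgn_succ, smul_zero,
      neg_smul, neg_neg, h', map_zero, TensorProduct.tmul_smul,
      Prod.mk_zero_zero, TensorProduct.tmul_zero, add_zero]
  | add x y hx hy => simp only [map_add, hx, hy, smul_add]

theorem eq_top_of_slot {s t : ℕ}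
    (U : Submodule k (((Fin s → k) × (Fin s → k)) ⊗[k] ((Fin t → k) × (Fin t → k))))
    (h₁₁ : ∀ z, slot ι₁ ι₁ z ∈ U) (h₁₂ : ∀ z, slot ι₁ ι₂ z ∈ U) (h₂₁ : ∀ z, slot ι₂ ι₁ z ∈ U)
    (h₂₂ : ∀ z, slot ι₂ ι₂ z ∈ U) : U = ⊤ := by
  rw [eq_top_iff, ← TensorProduct.span_tmul_eq_top, Submodule.span_le]
  rintro _ ⟨⟨x₁, x₂⟩, ⟨y₁, y₂⟩, rfl⟩
  have hx : (x₁, x₂) = LinearMap.inl k _ _ x₁ + LinearMap.inr k _ _ x₂ := by simp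
  have hy : (y₁, y₂) = LinearMap.inl k _ _ y₁ + LinearMap.inr k _ _ y₂ := by simp
  rw [hx, hy, TensorProduct.add_tmul, TensorProduct.tmul_add, TensorProduct.tmul_add]
  exact U.add_mem (U.add_mem (h₁₁ (x₁ ⊗ₜ y₁)) (h₁₂ (x₁ ⊗ₜ y₂)))
    (U.add_mem (h₂₁ (x₂ ⊗ₜ y₁)) (h₂₂ (x₂ ⊗ₜ y₂)))

/-- A submodule of `M_s(r, η) ⊗ M_t(r', η)` containing the generators of the summands in the
decomposition is the whole module. -/
theorem eq_top_of_generators (n : ℕ)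
    (U : Submodule k (((Fin s → k) × (Fin s → k)) ⊗[k] ((Fin (n + 1) → k) × (Fin (n + 1) → k))))
    (hU : ∀ x, ∀ v ∈ U, Rep.tensor (repM k s r η) (repM k (n + 1) r' η) x v ∈ U)
    (hd : ∀ x, slot ι₁ ι₁ (diag k s (n + 1) x) ∈ U)
    (hS : ∀ i (j : Fin n), slot ι₁ ι₁ (Pi.single i 1 ⊗ₜ Pi.single j.succ 1) ∈ U)
    (hl : ∀ x, slot ι₁ ι₂ (x ⊗ₜ Pi.single (Fin.last n) 1) ∈ U) : U = ⊤ := by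
  have hr := sgn_mul_self k r'
  have h₁₁ : ∀ z, slot ι₁ ι₁ z ∈ U := Submodule.eq_top_iff'.1
    (eq_top_of_diag (U.comap (slot ι₁ ι₁)) hd hS)
  have h₁₂ : ∀ z, slot ι₁ ι₂ z ∈ U := by
    refine Submodule.eq_top_iff'.1 (eq_top_of_shift (U.comap (slot ι₁ ι₂)) hl fun x y => ?_)
    -- In `P (N x ⊗ y)₁₁ - Q (x ⊗ y)₁₁` the components in slot 21 cancel, leaving `(N x ⊗ y - x ⊗ N
    -- y)₁₂`, as `eq_top_of_shift` requires.
    have h := U.sub_mem (hU (genP k η) _ (h₁₁ (shift k s x ⊗ₜ y)))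
      (hU (genQ k η) _ (h₁₁ (x ⊗ₜ y)))
    rw [tensor_P_slot₁₁, tensor_Q_slot₁₁, LinearMap.lTensor_tmul, LinearMap.rTensor_tmul,
      sub_sub_sub_cancel_right, ← map_sub] at h
    exact h
  have h₂₂ : ∀ z, slot ι₂ ι₂ z ∈ U := by
    intro z
    have h := U.smul_mem (sgn k r') (hU (genP k η) _ (h₁₂ z))
    rwa [tensor_P_slot₁₂, smul_smul, hr, one_smul] at h
  refine eq_top_of_slot U h₁₁ h₁₂ (fun z => ?_) h₂₂
  -- `z₁₂ - P z₁₁ = (-1)^r' z₂₁`, and the sign is its own inverse.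
  have h := U.smul_mem (sgn k r') (U.sub_mem (h₁₂ z) (hU (genP k η) _ (h₁₁ z)))
  rwa [tensor_P_slot₁₁, sub_sub_cancel, smul_smul, hr, one_smul] at h

theorem iso_tensor (n : ℕ) (hsn : s ≤ n + 1) :
    Iso (((repP k (r + r')).copies (s * n)).directSum
        ((repM k s (r + r') η).directSum (repM k s (r + r' + 1) η)))
      ((repM k s r η).tensor (repM k (n + 1) r' η)) := by
  -- The top half of `M_s(r + r' + 1, η)` has weight `(-1)^(r + r' + 2)`, which must match the
  -- weight of slot 11.
  have h2 : r + r' + 1 + 1 = r + r' := by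
    rw [add_assoc, show (1 + 1 : ZMod 2) = 0 from rfl, add_zero]
  -- One copy of `P(r + r')` for each `e_i ⊗ e_{j+1}` in slot 11; the index `0` in the second factor
  -- is left to `diag`.
  choose f hf hf' using fun i : Fin (s * n) =>
    exists_isHom_repP ((repM k s r η).tensor (repM k (n + 1) r' η)) (r + r')
      (slot ι₁ ι₁ (Pi.single (finProdFinEquiv.symm i).1 1 ⊗ₜ
        Pi.single (finProdFinEquiv.symm i).2.succ 1))
      (tensor_b_slot₁₁ ..) ((tensor_c_eq_b ..).trans (tensor_b_slot₁₁ ..))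
  obtain ⟨g, hg, hg'⟩ := exists_isHom_repM ((repM k s r η).tensor (repM k (n + 1) r' η)) s
    (r + r') η (slot ι₁ ι₂ ∘ₗ (TensorProduct.mk k _ _).flip (Pi.single (Fin.last n) 1))
    (fun x => by rw [LinearMap.comp_apply]; exact tensor_b_slot₁₂ ..)
    (fun x => by rw [LinearMap.comp_apply, tensor_c_eq_b]; exact tensor_b_slot₁₂ ..)
    (fun x => by
      rw [LinearMap.comp_apply, LinearMap.comp_apply, tensor_P_slot₁₂, tensor_Q_slot₁₂]
      rfl)
  -- On the image of `diag` both `N ⊗ 1` and `1 ⊗ N` become `N` on `x`, so `Q` on `diag x` equals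
  -- `P` on `diag (N x)`.
  obtain ⟨g', hg₁, hg₁'⟩ := exists_isHom_repM ((repM k s r η).tensor (repM k (n + 1) r' η)) s
    (r + r' + 1) η (slot ι₁ ι₁ ∘ₗ diag k s (n + 1))
    (fun x => by rw [h2]; exact tensor_b_slot₁₁ ..)
    (fun x => by rw [h2]; exact (tensor_c_eq_b ..).trans (tensor_b_slot₁₁ ..))
    (fun x => by
      rw [LinearMap.comp_apply, LinearMap.comp_apply, tensor_P_slot₁₁, tensor_Q_slot₁₁,
        lTensor_shift_diag hsn, rTensor_shift_diag])
  have hF := (IsHom.lsum hf).coprod (hg.coprod hg₁)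
  refine hF.iso_of_surjective (LinearMap.range_eq_top.1 ?_) ?_
  · refine eq_top_of_generators s r r' η n _ ?_ (fun x => ?_) (fun i j => ?_) (fun x => ?_)
    · rintro x _ ⟨v, rfl⟩
      exact ⟨_, hF x v⟩
    · exact ⟨(0, 0, x, 0), by simp [hg₁']⟩
    · exact ⟨(Pi.single (finProdFinEquiv (i, j)) (Pi.single 0 1), 0, 0), by
        rw [LinearMap.coprod_apply, LinearMap.lsum_piSingle, hf', Equiv.symm_apply_apply,
          Prod.mk_zero_zero, map_zero, add_zero]⟩
    · exact ⟨(0, (x, 0), 0), by simp [hg']⟩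
  -- The count is `4sn + 2s + 2s = 2s · 2(n + 1)`.
  · simp only [Module.finrank_prod, Module.finrank_pi_fintype, Module.finrank_self,
      Module.finrank_tensorProduct, Finset.sum_const, Finset.card_univ, Fintype.card_fin,
      smul_eq_mul]
    ring

end TensorM

end D4

theorem proposition2p32 {k : Type*} [Field k] [IsAlgClosed k] (hk : ringChar k ≠ 2)
    (s t : ℕ) (hs : 1 ≤ s) (hst : s ≤ t) (r r' : ZMod 2) (η : OnePoint k) :
    D4.Iso ((D4.repM k s r η).tensor (D4.repM k t r' η))
      (((D4.repP k (r + r')).copies (s * (t - 1))).directSum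
        ((D4.repM k s 0 η).directSum (D4.repM k s 1 η))) := by
  obtain ⟨n, rfl⟩ : ∃ n, t = n + 1 := ⟨t - 1, by omega⟩
  refine (D4.iso_tensor s r r' η n hst).symm.trans (.directSum (.refl _) ?_)
  -- The parities `r + r'` and `r + r' + 1` are `0` and `1` in some order, so at most a swap of the
  -- two summands remains.
  have h : r + r' = 0 ∨ r + r' = 1 := by
    generalize r + r' = x
    revert x
    decide
  rcases h with h | h <;> rw [h]
  · exact .refl _
  · exact D4.iso_directSum_comm _ _
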